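/- Let $R$ be an integral domain with quotient field $\mathrm{qf}(R)$. Call an integral domain $D$ *valuative* if for each $x\in \mathrm{qf}(D)$, there is no ring strictly between $D$ and $D[x]$ or there is no ring strictly between $D$ and $D[x^{-1}]$ (with the convention $0^{-1}=0$; the case of equality $D=D[x]$ or $D=D[x^{-1}]$ is allowed). Call $R$ a *maximal non valuative domain* if $R\neq \mathrm{qf}(R)$, $R$ is not valuative, and every subring of $\mathrm{qf}(R)$ that properly contains $R$ is valuative. Let $R$ be a maximal non valuative domain, and let $R'$ be the integral closure of $R$ in $\mathrm{qf}(R)$. Then $R'$ is a Prüfer domain, i.e. every nonzero finitely generated ideal of $R'$ is invertible. If moreover $R'$ is local, i.e. has a unique maximal ideal, then $R'$ is a valuation domain. -/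

import Mathlib

open scoped nonZeroDivisors

/-- An integral domain `R` with quotient field `K` is *valuative* if for every `x ∈ K` there is no
ring strictly between `R` and `R[x]`, or no ring strictly between `R` and `R[x⁻¹]`.
Here `⊥` is the copy of `R` in `K`, the subrings of `K` containing `R` are the `R`-subalgebras
of `K`, and `a ⩿ b` means `a ≤ b` with nothing strictly between (`a = b` is allowed). -/
def IsValuativeDomain (R : Type*) [CommRing R] [IsDomain R] : Prop :=
  ∀ x : FractionRing R,
    (⊥ : Subalgebra R (FractionRing R)) ⩿ Algebra.adjoin R {x} ∨
    (⊥ : Subalgebra R (FractionRing R)) ⩿ Algebra.adjoin R {x⁻¹}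

/-- For an extension `R ⊆ T` of integral domains (the structure map is injective), `R` is a
*maximal non valuative subring* of `T` if `R` is a proper subring of `T`, `R` is not valuative, and
every subring of `T` properly containing `R` is valuative. -/
def IsMaximalNonValuativeSubring (R T : Type*) [CommRing R] [IsDomain R] [CommRing T] [IsDomain T]
    [Algebra R T] [FaithfulSMul R T] : Prop :=
  (⊥ : Subalgebra R T) < ⊤ ∧ ¬ IsValuativeDomain R ∧
    ∀ S : Subalgebra R T, ⊥ < S → IsValuativeDomain S

/-- `R` is a *maximal non valuative domain* if it is a maximal non valuative subring of its
quotient field. -/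
def IsMaximalNonValuativeDomain (R : Type*) [CommRing R] [IsDomain R] : Prop :=
  IsMaximalNonValuativeSubring R (FractionRing R)

/-- A *Prüfer domain* is an integral domain in which every nonzero finitely generated ideal is
invertible (as a fractional ideal). -/
def IsPruferDomain (R : Type*) [CommRing R] [IsDomain R] : Prop :=
  ∀ I : Ideal R, I ≠ ⊥ → I.FG → IsUnit (I : FractionalIdeal R⁰ (FractionRing R))

/-! Write D for the integral closure. If D fails to be Prüfer, then at some maximal ideal P two
elements a, b do not divide one another even locally. Put x = b/a. As D is integrally closed,
Seidenberg's argument forces every polynomial vanishing at x to have all coefficients in P, so D[x]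
modulo P is a polynomial ring and nonconstant monic polynomials in x are nonunits. Four pairwise
coprime ones p, q, r, s break valuativity: adjoining pq/(rs) inverts r and s, adjoining its inverse
inverts p and q, and each can be done in two proper steps. Yet D[x] properly contains R. -/

open Polynomial in
/-- A form of Seidenberg's `u, u⁻¹` lemma: over an integrally closed base, a root of a polynomial
that has a coefficient outside a prime `P` lies in the localization at `P`, or its inverse does. -/
theorem exists_notMem_smul_eq_or_of_aeval_eq_zero {D K : Type*} [CommRing D] [IsDomain D] [Field K]
    [Algebra D K] [FaithfulSMul D K] [IsIntegrallyClosedIn D K] (P : Ideal D) [P.IsPrime] (x : K)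
    (f : D[X]) (hf : aeval x f = 0) (hP : ∃ i, f.coeff i ∉ P) :
    ∃ d ∉ P, ∃ c : D,
      algebraMap D K d * x = algebraMap D K c ∨ algebraMap D K c * x = algebraMap D K d := by
  have hinj : Function.Injective (algebraMap D K) := FaithfulSMul.algebraMap_injective D K
  obtain ⟨n, hn⟩ : ∃ n, f.natDegree ≤ n := ⟨_, le_rfl⟩
  induction n generalizing f with
  | zero =>
    obtain ⟨i, hi⟩ := hP
    rw [eq_C_of_natDegree_le_zero hn] at hf hi
    rw [aeval_C] at hf
    rw [(map_eq_zero_iff _ hinj).1 hf] at hi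
    simp at hi
  | succ n ih =>
    by_cases h0 : f.coeff (n + 1) = 0
    · refine ih f hf hP ?_
      rw [natDegree_le_iff_coeff_eq_zero] at hn ⊢
      intro N hN
      rcases (Nat.succ_le_of_lt hN).eq_or_lt with h | h
      · rw [← h]; exact h0
      · exact hn N h
    have hdeg : f.natDegree = n + 1 := le_antisymm hn (le_natDegree_of_ne_zero h0)
    have hint : IsIntegral D (f.leadingCoeff • x) := isIntegral_leadingCoeff_smul f x hf
    obtain ⟨b, hb⟩ := IsIntegrallyClosedIn.isIntegral_iff.1 hint
    rw [leadingCoeff, hdeg, Algebra.smul_def] at hb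
    by_cases hlead : f.coeff (n + 1) ∈ P
    swap
    · exact ⟨_, hlead, b, Or.inl hb.symm⟩
    by_cases hbP : b ∈ P
    swap
    · exact ⟨b, hbP, _, Or.inr hb.symm⟩
    -- Since b is the leading coefficient times x, trading the top term for b X^n keeps the root,
    -- lowers the degree bound and changes coefficients only by elements of P.
    let g : D[X] := f - monomial (n + 1) (f.coeff (n + 1)) + monomial n b
    refine ih g ?_ ?_ ?_
    · simp only [g, map_add, map_sub, hf, aeval_monomial, hb]
      ring
    · obtain ⟨i, hi⟩ := hP
      refine ⟨i, fun hg => hi ?_⟩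
      have hfi : f.coeff i = g.coeff i + (if n + 1 = i then f.coeff (n + 1) else 0)
          - (if n = i then b else 0) := by
        simp only [g, coeff_add, coeff_sub, coeff_monomial]
        ring
      rw [hfi]
      refine P.sub_mem (P.add_mem hg ?_) ?_ <;> split_ifs <;>
        first | exact hlead | exact hbP | exact P.zero_mem
    · rw [natDegree_le_iff_coeff_eq_zero]
      intro N hN
      simp only [g, coeff_add, coeff_sub, coeff_monomial, if_neg hN.ne, add_zero]
      split_ifs with h
      · rw [h, sub_self]
      · rw [sub_zero]
        exact natDegree_le_iff_coeff_eq_zero.1 hn N (by omega)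

/-- Inverting a product of two coprime nonunits can be done in two proper steps. -/
theorem not_bot_wcovBy_adjoin_div {S F : Type*} [CommRing S] [Field F] [Algebra S F]
    [FaithfulSMul S F] {g p q : S} (hp : ¬ IsUnit p) (hq : ¬ IsUnit q) (hpq : IsCoprime p q)
    (hg : IsCoprime g (p * q)) (h0 : p * q ≠ 0) :
    ¬ (⊥ : Subalgebra S F) ⩿
      Algebra.adjoin S {algebraMap S F g / algebraMap S F (p * q)} := by
  have hinj : Function.Injective (algebraMap S F) := FaithfulSMul.algebraMap_injective S F
  have hpq0 : algebraMap S F (p * q) ≠ 0 := (map_ne_zero_iff _ hinj).2 h0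
  have hp0 : algebraMap S F p ≠ 0 := fun h => hpq0 (by rw [map_mul, h, zero_mul])
  have hq0 : algebraMap S F q ≠ 0 := fun h => hpq0 (by rw [map_mul, h, mul_zero])
  set y := algebraMap S F g / algebraMap S F (p * q) with hy
  have hinv : (algebraMap S F (p * q))⁻¹ ∈ Algebra.adjoin S {y} := by
    obtain ⟨a, b, hab⟩ := hg
    have : (algebraMap S F (p * q))⁻¹ = algebraMap S F a * y + algebraMap S F b := by
      rw [hy, inv_eq_one_div, ← map_one (algebraMap S F), ← hab, map_add, map_mul, map_mul _ b]
      field_simp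
    rw [this]
    exact add_mem (mul_mem (Subalgebra.algebraMap_mem _ _) (Algebra.self_mem_adjoin_singleton S y))
      (Subalgebra.algebraMap_mem _ _)
  have hpinv : (algebraMap S F p)⁻¹ ∈ Algebra.adjoin S {y} := by
    have : (algebraMap S F p)⁻¹ = algebraMap S F q * (algebraMap S F (p * q))⁻¹ := by
      rw [map_mul]; field_simp
    rw [this]
    exact mul_mem (Subalgebra.algebraMap_mem _ _) hinv
  have hqinv : (algebraMap S F q)⁻¹ ∈ Algebra.adjoin S {y} := by
    have : (algebraMap S F q)⁻¹ = algebraMap S F p * (algebraMap S F (p * q))⁻¹ := by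
      rw [map_mul]; field_simp
    rw [this]
    exact mul_mem (Subalgebra.algebraMap_mem _ _) hinv
  intro h
  refine h.2 (c := Algebra.adjoin S {(algebraMap S F p)⁻¹}) (bot_lt_iff_ne_bot.2 fun hbot => ?_)
    (lt_of_le_of_ne (Algebra.adjoin_le (Set.singleton_subset_iff.2 hpinv)) fun heq => ?_)
  · have hmem := Algebra.self_mem_adjoin_singleton S (algebraMap S F p)⁻¹
    rw [hbot, Algebra.mem_bot] at hmem
    obtain ⟨s, hs⟩ := hmem
    refine hp (IsUnit.of_mul_eq_one s (hinj ?_))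
    rw [map_mul, hs, mul_inv_cancel₀ hp0, map_one]
  · rw [← heq] at hqinv
    -- Powers of p clear denominators in S[1/p]; if 1/q lay there, q would divide some p^n, against
    -- coprimality.
    have key : ∀ z ∈ Algebra.adjoin S {(algebraMap S F p)⁻¹},
        ∃ n : ℕ, ∃ s : S, algebraMap S F p ^ n * z = algebraMap S F s := by
      intro z hz
      induction hz using Algebra.adjoin_induction with
      | mem z hz => exact ⟨1, 1, by rw [Set.mem_singleton_iff.1 hz, pow_one, map_one,
          mul_inv_cancel₀ hp0]⟩
      | algebraMap r => exact ⟨0, r, by simp⟩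
      | add u v _ _ hu hv =>
        obtain ⟨n, s, hs⟩ := hu
        obtain ⟨m, t, ht⟩ := hv
        refine ⟨n + m, p ^ m * s + p ^ n * t, ?_⟩
        rw [map_add, map_mul, map_mul, ← hs, ← ht, map_pow, map_pow]
        ring
      | mul u v _ _ hu hv =>
        obtain ⟨n, s, hs⟩ := hu
        obtain ⟨m, t, ht⟩ := hv
        refine ⟨n + m, s * t, ?_⟩
        rw [map_mul, ← hs, ← ht]
        ring
    obtain ⟨n, s, hs⟩ := key _ hqinv
    have hdvd : q ∣ p ^ n := by
      refine ⟨s, hinj ?_⟩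
      rw [map_mul, ← hs, map_pow]
      field_simp
    exact hq ((hpq.pow_left (m := n)).isUnit_of_dvd' hdvd dvd_rfl)

/-- A valuative domain does not contain four pairwise coprime nonunits. -/
theorem not_isValuativeDomain_of_isCoprime {S : Type*} [CommRing S] [IsDomain S] {p q r s : S}
    (hp : ¬ IsUnit p) (hq : ¬ IsUnit q) (hr : ¬ IsUnit r) (hs : ¬ IsUnit s)
    (hpq : IsCoprime p q) (hrs : IsCoprime r s) (h : IsCoprime (p * q) (r * s)) :
    ¬ IsValuativeDomain S := by
  have hrs0 : r * s ≠ 0 := fun h0 => by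
    rw [h0, isCoprime_zero_right] at h
    exact hp (isUnit_of_mul_isUnit_left h)
  have hpq0 : p * q ≠ 0 := fun h0 => by
    rw [h0, isCoprime_zero_left] at h
    exact hr (isUnit_of_mul_isUnit_left h)
  intro hv
  rcases hv (algebraMap S (FractionRing S) (p * q) / algebraMap S (FractionRing S) (r * s))
    with hc | hc
  · exact not_bot_wcovBy_adjoin_div hr hs hrs h hrs0 hc
  · rw [inv_div] at hc
    exact not_bot_wcovBy_adjoin_div hp hq hpq h.symm hpq0 hc

open Polynomial in
/-- If every polynomial vanishing at `x` has all its coefficients in the prime `P`, then `D[x]`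
maps onto `(D ⧸ P)[X]`, so it is not valuative. -/
theorem not_isValuativeDomain_adjoin {D K : Type*} [CommRing D] [Field K] [Algebra D K]
    (P : Ideal D) [P.IsPrime] (x : K)
    (hx : ∀ f : D[X], aeval x f = 0 → ∀ i, f.coeff i ∈ P) :
    ¬ IsValuativeDomain (Algebra.adjoin D {x}) := by
  let ξ : Algebra.adjoin D {x} := ⟨x, Algebra.self_mem_adjoin_singleton D x⟩
  have nonunit : ∀ p : D[X], p.Monic → p.natDegree ≠ 0 → ¬ IsUnit (aeval ξ p) := by
    intro p hp hdeg hu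
    obtain ⟨s, hs⟩ := hu.exists_right_inv
    obtain ⟨g, hg⟩ := (Algebra.adjoin_singleton_eq_range_aeval D x).le s.2
    have h0 : aeval x (p * g - 1) = 0 := by
      have := congrArg (Subalgebra.val _) hs
      rw [map_mul, ← aeval_algHom_apply, map_one] at this
      rw [map_sub, map_mul, map_one, sub_eq_zero]
      exact (congrArg (aeval x p * ·) hg).trans this
    -- Modulo P the inverse of p(x) becomes a polynomial inverse of a monic polynomial, which must
    -- then be 1.
    have hmap : (p.map (Ideal.Quotient.mk P)) * g.map (Ideal.Quotient.mk P) = 1 := by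
      rw [← sub_eq_zero, ← Polynomial.map_mul, ← Polynomial.map_one (Ideal.Quotient.mk P),
        ← Polynomial.map_sub]
      ext i
      rw [coeff_map, coeff_zero]
      exact Ideal.Quotient.eq_zero_iff_mem.2 (hx _ h0 i)
    have hone := (hp.map (Ideal.Quotient.mk P)).eq_one_of_isUnit (IsUnit.of_mul_eq_one _ hmap)
    apply hdeg
    rw [← hp.natDegree_map (Ideal.Quotient.mk P), hone, natDegree_one]
  rcases subsingleton_or_nontrivial D with hD | hD
  · exact absurd (Subsingleton.elim _ _) (Ideal.IsPrime.ne_top ‹P.IsPrime›)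
  -- Euclid's trick: with u = X(X - 1), the last two are u + 1 and u(u + 1) + 1, so the Bézout
  -- identities have integer coefficients and hold over any D.
  have h1 := nonunit X monic_X (by simp)
  have h2 := nonunit (X - 1) (by monicity!) (by
    rw [show (X - 1 : D[X]).natDegree = 1 by compute_degree!]; norm_num)
  have h3 := nonunit (X ^ 2 - X + 1) (by monicity!) (by
    rw [show (X ^ 2 - X + 1 : D[X]).natDegree = 2 by compute_degree!]; norm_num)
  have h4 := nonunit (X ^ 4 - 2 * X ^ 3 + 2 * X ^ 2 - X + 1) (by monicity!) (by
    rw [show (X ^ 4 - 2 * X ^ 3 + 2 * X ^ 2 - X + 1 : D[X]).natDegree = 4 by compute_degree!]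
    norm_num)
  refine not_isValuativeDomain_of_isCoprime h1 h2 h3 h4 ⟨1, -1, ?_⟩
    ⟨-(ξ ^ 2 - ξ), 1, ?_⟩ ⟨-((ξ ^ 2 - ξ) ^ 2 + 2 * (ξ ^ 2 - ξ) + 2), 1, ?_⟩ <;>
  · simp only [map_add, map_sub, map_mul, map_pow, map_one, aeval_X, map_ofNat]
    ring

/-- If, at every maximal ideal `P`, of any two elements one divides the other after multiplication
by an element outside `P`, then the domain is a Prüfer domain. -/
theorem isPruferDomain_of_exists_dvd {D : Type*} [CommRing D] [IsDomain D]
    (h : ∀ P : Ideal D, P.IsMaximal → ∀ a b : D, ∃ d ∉ P, a ∣ d * b ∨ b ∣ d * a) :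
    IsPruferDomain D := by
  have gen : ∀ P : Ideal D, P.IsMaximal → ∀ s : Finset D, s.Nonempty →
      ∃ a ∈ s, ∃ d ∉ P, ∀ b ∈ s, a ∣ d * b := by
    intro P hP s hs
    have := hP.isPrime
    induction hs using Finset.Nonempty.cons_induction with
    | singleton a =>
      exact ⟨a, by simp, 1, P.one_notMem, by simp⟩
    | cons c s hc _ ih =>
      obtain ⟨a, ha, d, hd, had⟩ := ih
      obtain ⟨e, he, hac | hca⟩ := h P hP a c
      · refine ⟨a, by simp [ha], d * e, fun hde => (this.mem_or_mem hde).elim hd he, ?_⟩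
        intro b hb
        rcases Finset.mem_cons.1 hb with rfl | hb
        · rw [mul_assoc]; exact hac.mul_left d
        · rw [mul_right_comm]; exact (had b hb).mul_right e
      · refine ⟨c, by simp, d * e, fun hde => (this.mem_or_mem hde).elim hd he, ?_⟩
        intro b hb
        rcases Finset.mem_cons.1 hb with rfl | hb
        · exact dvd_mul_left _ _
        · obtain ⟨t, ht⟩ := had b hb
          rw [mul_right_comm, ht, mul_right_comm, mul_comm a e]
          exact hca.mul_right t
  intro I hI hfg
  obtain ⟨s, rfl⟩ := hfg
  set I := Ideal.span (s : Set D)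
  have hI0 : (I : FractionalIdeal (nonZeroDivisors D) (FractionRing D)) ≠ 0 :=
    FractionalIdeal.coeIdeal_ne_zero.2 hI
  refine FractionalIdeal.mul_inv_cancel_iff_isUnit _ |>.1 ?_
  -- J is I · I⁻¹. It lies in no maximal P: if a generates I locally at P, then d = a · (d/a) is in
  -- J but not in P.
  obtain ⟨J, hJ⟩ := FractionalIdeal.le_one_iff_exists_coeIdeal.1
    (FractionalIdeal.mul_one_div_le_one (I := (I : FractionalIdeal (nonZeroDivisors D)
      (FractionRing D))))
  rw [← FractionalIdeal.inv_eq] at hJ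
  rw [← hJ, ← FractionalIdeal.coeIdeal_top]
  congr 1
  by_contra hJtop
  obtain ⟨P, hP, hJP⟩ := Ideal.exists_le_maximal J hJtop
  have hs : s.Nonempty := by
    rw [Finset.nonempty_iff_ne_empty]
    rintro rfl
    exact hI (by simp [I])
  obtain ⟨a, ha, d, hd, had⟩ := gen P hP s hs
  have hdiv : ∀ z ∈ I, a ∣ d * z := fun z hz => by
    refine Submodule.span_induction (p := fun z _ => a ∣ d * z) had ?_ ?_ ?_ hz
    · rw [mul_zero]; exact dvd_zero a
    · intro u v _ _ hu hv; rw [mul_add]; exact dvd_add hu hv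
    · intro c u _ hu; rw [smul_eq_mul, mul_left_comm]; exact hu.mul_left c
  have ha0 : a ≠ 0 := by
    rintro rfl
    have hd0 : d ≠ 0 := fun h0 => hd (h0 ▸ P.zero_mem)
    refine hI (eq_bot_iff.2 fun z hz => ?_)
    exact (mul_eq_zero.1 (zero_dvd_iff.1 (hdiv z hz))).resolve_left hd0
  have ha0' : algebraMap D (FractionRing D) a ≠ 0 := by simpa using ha0
  refine hd (hJP ?_)
  have hmem : algebraMap D (FractionRing D) d ∈
      (J : FractionalIdeal (nonZeroDivisors D) (FractionRing D)) := by
    rw [hJ, ← mul_div_cancel₀ (algebraMap D (FractionRing D) d) ha0']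
    refine FractionalIdeal.mul_mem_mul
      (FractionalIdeal.mem_coeIdeal_of_mem _ (Ideal.subset_span ha))
      ((FractionalIdeal.mem_inv_iff hI0).2 fun y hy => ?_)
    obtain ⟨z, hz, rfl⟩ := (FractionalIdeal.mem_coeIdeal _).1 hy
    obtain ⟨c, hc⟩ := hdiv z hz
    refine (FractionalIdeal.mem_one_iff _).2 ⟨c, ?_⟩
    rw [div_mul_eq_mul_div, ← map_mul, hc, map_mul, mul_div_cancel_left₀ _ ha0']
  obtain ⟨d', hd', h'⟩ := (FractionalIdeal.mem_coeIdeal _).1 hmem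
  rwa [IsFractionRing.injective D (FractionRing D) h'] at hd'

theorem corollary2p3 (R : Type*) [CommRing R] [IsDomain R]
    (hR : IsMaximalNonValuativeDomain R) :
    IsPruferDomain (integralClosure R (FractionRing R)) ∧
      (IsLocalRing (integralClosure R (FractionRing R)) →
        ValuationRing (integralClosure R (FractionRing R))) := by
  have key : ∀ P : Ideal (integralClosure R (FractionRing R)), P.IsMaximal →
      ∀ a b, ∃ d ∉ P, a ∣ d * b ∨ b ∣ d * a := by
    intro P hP a b
    have hprime := hP.isPrime
    by_contra! hab
    have ha : (a : FractionRing R) ≠ 0 := fun ha => by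
      refine (hab 1 P.one_notMem).2 ?_
      have ha0 : a = 0 := Subtype.ext ha
      rw [ha0, mul_zero]
      exact dvd_zero b
    set x : FractionRing R := b / a with hx
    have hxP : ¬ ∃ d ∉ P, ∃ c : integralClosure R (FractionRing R),
        algebraMap _ (FractionRing R) d * x = algebraMap _ (FractionRing R) c ∨
        algebraMap _ (FractionRing R) c * x = algebraMap _ (FractionRing R) d := by
      rintro ⟨d, hd, c, h | h⟩
      · refine (hab d hd).1 ⟨c, Subtype.ext ?_⟩
        change (d : FractionRing R) * x = c at h
        change (d : FractionRing R) * b = a * c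
        rw [← h, hx]
        field_simp
      · refine (hab d hd).2 ⟨c, Subtype.ext ?_⟩
        change (c : FractionRing R) * x = d at h
        change (d : FractionRing R) * a = b * c
        rw [← h, hx]
        field_simp
    refine not_isValuativeDomain_adjoin P x (fun f hf i => ?_)
      (hR.2.2 ((Algebra.adjoin (integralClosure R (FractionRing R)) {x}).restrictScalars R)
        (bot_lt_iff_ne_bot.2 fun hbot => ?_))
    · by_contra hi
      exact hxP (exists_notMem_smul_eq_or_of_aeval_eq_zero P x f hf ⟨i, hi⟩)
    · have hmem : x ∈ (Algebra.adjoin (integralClosure R (FractionRing R)) {x}).restrictScalars R :=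
        Algebra.self_mem_adjoin_singleton _ x
      rw [hbot, Algebra.mem_bot] at hmem
      obtain ⟨r, hr⟩ := hmem
      exact hxP ⟨1, P.one_notMem, algebraMap R _ r, Or.inl (by rw [map_one, one_mul, ← hr]; rfl)⟩
  refine ⟨isPruferDomain_of_exists_dvd key, fun hloc => ?_⟩
  refine ValuationRing.iff_dvd_total.2 ⟨fun a b => ?_⟩
  obtain ⟨d, hd, h⟩ := key (IsLocalRing.maximalIdeal _) inferInstance a b
  have hu : IsUnit d := by rwa [IsLocalRing.mem_maximalIdeal, mem_nonunits_iff, not_not] at hd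
  rwa [hu.dvd_mul_left, hu.dvd_mul_left] at h
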